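/- **Theorem 4.2.** *Setting.* Consider a strategic game with $n$ players, nonempty closed convex action spaces $S_i\subseteq\mathbb R^{k_i}$, payoff functions $\pi_i$ and best reply mappings $f_i:\prod_{j\ne i}S_j\to S_i$, i.e. $\pi_i(q_i,q_{-i})<\pi_i(f_i(q_{-i}),q_{-i})$ for all $q\in S:=S_1\times\dots\times S_n$ with $q_i\neq f_i(q_{-i})$. Let $q^*\in S$ be a Nash equilibrium: $q_i^*=f_i(q_{-i}^*)$ for all $i$. Let $\mathcal N$ be the class of non-decreasing continuous $\gamma:\mathbb R^+\to\mathbb R^+$ with $\gamma(0)=0$, and suppose that there are $\tilde\gamma_{i,j}\in\mathcal N$ ($j\ne i$) with $$|f_i(q_{-i})-q_i^*|\le\max_{j\neq i}\tilde\gamma_{i,j}(|q_j-q_j^*|)\qquad\text{for all } q\in S,\ i=1,\dots,n$$ (Euclidean norms; the maximum over the empty set is $0$). Let $0\le\Theta<1$ and $0<r\le T$ be constants. *Hypothesis (H').* The players are partitioned into ordered groups: $J_1,\dots,J_m\subseteq\{1,\dots,n\}$ are pairwise disjoint with union $\{1,\dots,n\}$. A player $i\in J_k$ uses toward $j\in J_l$,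 $j\neq i$, a rational-consistent backward-looking expectation if $l>k$, i.e. $q^{\exp}_{i,j}(t)\in S_j$ with $|q^{\exp}_{i,j}(t)-q_j^*|\le\sup_{t-T\le s\le t}|q_j(s)-q_j^*|$, and a consistent backward-looking expectation if $l\le k$, i.e. the same with the supremum over $t-T\le s\le t-r$. In the deviation variables $x_i=q_i-q_i^*$ the dynamics of the game are then given by the uncertain system $$x_i(t)=\theta_i(t)\bigl(\mathrm{Pr}_{S_i}(x_i(t-\tau_i(t))+q_i^*)-q_i^*\bigr)+(1-\theta_i(t))\Bigl(f_i\bigl((\mathrm{Pr}_{S_j}(q_j^*+d_{i,j}(t)\,s_{i,j}(t)))_{j\neq i}\bigr)-q_i^*\Bigr),\quad t>0,\ i=1,\dots,n,\tag{4.2}$$ where $\mathrm{Pr}_U$ is the projection on $U$, $s_{i,j}(t)=\sup_{t-T\le s\le t}|x_j(s)|$ if $i\in J_k$, $j\in J_l$ with $l>k$, and $s_{i,j}(t)=\sup_{t-T\le s\le t-r}|x_j(s)|$ if $l\le k$. The inputs are arbitrary functions $\theta_i:\mathbb R^+\to[0,\Theta]$, $\tau_i:\mathbb R^+\to[r,T]$,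 $d_{i,j}:\mathbb R^+\to\{d\in\mathbb R^{k_j}:|d|\le1\}$ ($j\ne i$). The state at time $t\ge0$ is $x_t=\{x(t+s):-T\le s\le0\}\in\mathcal X$, where $\mathcal X$ is the normed space of bounded functions $[-T,0]\to\mathbb R^{k_1+\dots+k_n}$ with the supremum norm; the initial condition is an arbitrary $x_0\in\mathcal X$. *Claim.* Suppose that there is $\omega>1$ such that, with $\gamma_{i,j}(s):=\omega\tilde\gamma_{i,j}(\omega s)$, the cyclic small-gain conditions $$(\gamma_{i_1,i_2}\circ\gamma_{i_2,i_3}\circ\dots\circ\gamma_{i_p,i_1})(s)<s\quad\text{for all } s>0\tag{3.15}$$ hold for each $p=2,\dots,n$ and all pairwise distinct $i_1,\dots,i_p\in\{1,\dots,n\}$. Then $0\in\mathcal X$ is robustly globally asymptotically stable for (4.2): for every $x_0\in\mathcal X$ and all inputs there is exactly one solution $x_t\in\mathcal X$, defined for all $t\ge0$, and - (Lagrange stability) for every $R\ge 0$, $\|x_t\|_{\mathcal X}$ is bounded uniformly over all $t\ge0$, all inputs and all $\|x_0\|_{\mathcal X}\le R$; - (Lyapunov stability) for every $\varepsilon>0$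 there is $\delta>0$ such that $\|x_0\|_{\mathcal X}\le\delta$ implies $\|x_t\|_{\mathcal X}\le\varepsilon$ for all $t\ge0$ and all inputs; - (uniform attractivity) for all $\varepsilon>0$, $R\ge0$ there is $t_0\ge0$ such that $\|x_0\|_{\mathcal X}\le R$ implies $\|x_t\|_{\mathcal X}\le\varepsilon$ for all $t\ge t_0$ and all inputs. -/

import Mathlib

open scoped NNReal ENNReal

noncomputable section

/-- Functions of class `N`: non-decreasing, continuous, vanishing at zero. -/
structure IsClassN (γ : ℝ≥0 → ℝ≥0) : Prop where
  monotone : Monotone γ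
  continuous : Continuous γ
  map_zero : γ 0 = 0

/-- The composition `γ (c 0) (c 1) ∘ γ (c 1) (c 2) ∘ ⋯ ∘ γ (c (p - 1)) (c 0)` of gains along the
cycle `c` (`finRotate p` is the cyclic successor `j ↦ j + 1` on `Fin p`). -/
def cycleGain {n p : ℕ} (γ : Fin n → Fin n → ℝ≥0 → ℝ≥0) (c : Fin p → Fin n) : ℝ≥0 → ℝ≥0 :=
  (List.ofFn fun j : Fin p => γ (c j) (c (finRotate p j))).foldr (fun g h => g ∘ h) id

/-- The cyclic small-gain conditions: along every cycle of `p = 2, …, n` pairwise distinct indices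
the composed gain is strictly below the identity on the positive half-line. -/
def CyclicSmallGain {n : ℕ} (γ : Fin n → Fin n → ℝ≥0 → ℝ≥0) : Prop :=
  ∀ p : ℕ, 2 ≤ p → p ≤ n → ∀ c : Fin p → Fin n, Function.Injective c →
    ∀ s : ℝ≥0, 0 < s → cycleGain γ c s < s

/-- The projection of `x` on a nonempty closed set `U`: a point of `U` at minimal distance from `x`
(it is unique when `U` is convex). -/
def projOn {E : Type*} [MetricSpace E] [ProperSpace E] {U : Set E} (hc : IsClosed U)
    (hne : U.Nonempty) (x : E) : U :=
  ⟨(hc.exists_infDist_eq_dist hne x).choose, (hc.exists_infDist_eq_dist hne x).choose_spec.1⟩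

theorem dist_projOn {E : Type*} [MetricSpace E] [ProperSpace E] {U : Set E} (hc : IsClosed U)
    (hne : U.Nonempty) (x : E) : Metric.infDist x U = dist x (projOn hc hne x : E) :=
  (hc.exists_infDist_eq_dist hne x).choose_spec.2

/-- `‖x‖_[a,b] = sup_{a ≤ s ≤ b} |x s|`. -/
def supNormOn {E : Type*} [Norm E] (x : ℝ → E) (a b : ℝ) : ℝ :=
  ⨆ s : Set.Icc a b, ‖x s‖

/-- Robust global asymptotic stability of `0` for an uncertain autonomous dynamical system on the
normed space `X`, with inputs (disturbances) in `D`, where `IsTraj x₀ d ξ` says that `ξ` is the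
evolution of the state from `x₀` at time `0` under the input `d`. The system is well posed (from
every initial state and for every input there is exactly one evolution, defined for all times), and
`0` is Lagrange stable, Lyapunov stable and attractive, in each case uniformly over all inputs. -/
structure RobustlyGloballyAsymptoticallyStable {X D : Type*} [NormedAddCommGroup X]
    (IsTraj : X → D → (ℝ≥0 → X) → Prop) : Prop where
  wellPosed : ∀ (x₀ : X) (d : D), ∃! ξ : ℝ≥0 → X, IsTraj x₀ d ξ
  lagrange : ∀ R : ℝ, ∃ M : ℝ, ∀ (x₀ : X) (d : D) (ξ : ℝ≥0 → X),
    IsTraj x₀ d ξ → ‖x₀‖ ≤ R → ∀ t : ℝ≥0, ‖ξ t‖ ≤ M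
  lyapunov : ∀ ε : ℝ, 0 < ε → ∃ δ : ℝ, 0 < δ ∧ ∀ (x₀ : X) (d : D) (ξ : ℝ≥0 → X),
    IsTraj x₀ d ξ → ‖x₀‖ ≤ δ → ∀ t : ℝ≥0, ‖ξ t‖ ≤ ε
  attractive : ∀ ε : ℝ, 0 < ε → ∀ R : ℝ, ∃ t₀ : ℝ≥0, ∀ (x₀ : X) (d : D) (ξ : ℝ≥0 → X),
    IsTraj x₀ d ξ → ‖x₀‖ ≤ R → ∀ t : ℝ≥0, t₀ ≤ t → ‖ξ t‖ ≤ ε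

/-- A strategic game with `n` players: closed convex action spaces `S i ⊆ ℝ^(k i)`, payoff
functions, and best reply mappings, where the best reply of player `i` to the actions of the other
players is the unique maximizer of the payoff of player `i`. -/
structure StrategicGame (n : ℕ) where
  k : Fin n → ℕ
  S : (i : Fin n) → Set (EuclideanSpace ℝ (Fin (k i)))
  isClosed_S : ∀ i, IsClosed (S i)
  convex_S : ∀ i, Convex ℝ (S i)
  payoff : Fin n → ((j : Fin n) → S j) → ℝ
  bestReply : (i : Fin n) → ((j : {j : Fin n // j ≠ i}) → S j) → S i
  payoff_lt : ∀ (i : Fin n) (q : (j : Fin n) → S j), q i ≠ bestReply i (fun j => q j) →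
    payoff i q < payoff i (Function.update q i (bestReply i fun j => q j))

namespace StrategicGame

variable {n : ℕ} (G : StrategicGame n)

/-- `q` is a Nash equilibrium: every action is the best reply to the other ones. -/
def IsNash (q : (i : Fin n) → G.S i) : Prop :=
  ∀ i, q i = G.bestReply i (fun j => q j)

/-- `ℝ^N` with `N = k 1 + ⋯ + k n` and the Euclidean norm, split into the players' blocks. -/
abbrev Profile : Type := PiLp 2 fun i : Fin n => EuclideanSpace ℝ (Fin (G.k i))

/-- The state space: bounded functions `[-T, 0] → ℝ^N` with the supremum norm. -/
abbrev State (T : ℝ) : Type := lp (fun _ : Set.Icc (-T) (0 : ℝ) => G.Profile) ∞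

/-- The unknown inputs: `θ i : ℝ⁺ → [0, Θ]`, `τ i : ℝ⁺ → [r, T]` and, for `j ≠ i`,
`d i j : ℝ⁺ → {d ∈ ℝ^(k j) : |d| ≤ 1}`. -/
structure Input (Θ r T : ℝ) where
  θ : Fin n → ℝ≥0 → Set.Icc (0 : ℝ) Θ
  τ : Fin n → ℝ≥0 → Set.Icc r T
  d : (i : Fin n) → (j : {j : Fin n // j ≠ i}) → ℝ≥0 →
    Metric.closedBall (0 : EuclideanSpace ℝ (Fin (G.k j))) 1

/-- The projection `Pr_{S i}`. The equilibrium `q` only witnesses that `S i` is nonempty. -/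
def proj (q : (i : Fin n) → G.S i) (i : Fin n) (y : EuclideanSpace ℝ (Fin (G.k i))) : G.S i :=
  projOn (G.isClosed_S i) ⟨q i, (q i).2⟩ y

open Classical in
/-- The quantity `s_{i,j}(t)`: it is `‖x_j‖_[t-T,t]` if `i ∈ J a` and `j ∈ J b` with `b > a`
(player `i` has a rational-consistent expectation toward `j`), and `‖x_j‖_[t-T,t-r]` otherwise
(player `i` has a consistent backward-looking expectation toward `j`). -/
def expSize {m : ℕ} (J : Fin m → Set (Fin n)) (r T : ℝ) (x : ℝ → G.Profile) (i j : Fin n)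
    (t : ℝ) : ℝ :=
  if ∃ a b : Fin m, a < b ∧ i ∈ J a ∧ j ∈ J b then supNormOn (fun s => x s j) (t - T) t
  else supNormOn (fun s => x s j) (t - T) (t - r)

/-- The right-hand side for player `i` at time `t` of the uncertain system in the deviation
variables `x_i = q_i - q_i^*`. -/
def rhs {m : ℕ} (J : Fin m → Set (Fin n)) (q : (i : Fin n) → G.S i) {Θ r T : ℝ}
    (u : G.Input Θ r T) (x : ℝ → G.Profile) (i : Fin n) (t : ℝ≥0) :
    EuclideanSpace ℝ (Fin (G.k i)) :=
  (u.θ i t : ℝ) • ((G.proj q i (x (t - u.τ i t) i + q i) : EuclideanSpace ℝ (Fin (G.k i))) - q i)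
    + (1 - (u.θ i t : ℝ)) •
      ((G.bestReply i (fun j => G.proj q j
          ((q j : EuclideanSpace ℝ (Fin (G.k j))) +
            G.expSize J r T x i j t • (u.d i j t : EuclideanSpace ℝ (Fin (G.k j))))) :
        EuclideanSpace ℝ (Fin (G.k i))) - q i)

/-- `ξ` is the evolution `t ↦ x_t`, `x_t(s) = x(t + s)` for `s ∈ [-T, 0]`, of the state along a
solution `x` on `[-T, ∞)` of the uncertain system with initial condition `x₀` on `[-T, 0]` and
input `u`. (Values of the representative `x : ℝ → ℝ^N` before time `-T` play no role.) -/
def IsTrajectory {m : ℕ} (J : Fin m → Set (Fin n)) (q : (i : Fin n) → G.S i) (Θ r T : ℝ)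
    (x₀ : G.State T) (u : G.Input Θ r T) (ξ : ℝ≥0 → G.State T) : Prop :=
  ∃ x : ℝ → G.Profile,
    (∀ s : Set.Icc (-T) (0 : ℝ), x s = x₀ s) ∧
    (∀ t : ℝ≥0, 0 < t → ∀ i, x t i = G.rhs J q u x i t) ∧
    ∀ (t : ℝ≥0) (s : Set.Icc (-T) (0 : ℝ)), ξ t s = x (t + s)

end StrategicGame

end

/-!
A family of levels `v` with `v i ≤ max ρ (max_{j ≠ i} γ i j (v j))` is small when `ρ` is. Indeed a
level `v i` above `ρ` is accounted for by the gain from some `j`; tracing it back in this way for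
`n` steps either meets a level at most `ρ`, or runs into a cycle, which the cyclic small-gain
condition rules out. The suprema of a solution are such levels, with `ρ` the size of the initial
condition, and so are the least ultimate bounds over all solutions and inputs, with `ρ = 0`: bounds
on the past improve to means of themselves and of the gains, and as the weight on the own past is at
most `Θ < 1`, this inertia drops out in the infimum of all bounds.

Well-posedness, and the local boundedness that makes those suprema finite, come from causality: the
action of player `i` at time `t` depends on actions at times at most `t - r` and on the present of
the players toward whom `i` is rational, and this dependence is well-founded.
-/

noncomputable section

section Gains

variable {n : ℕ} {γ γ' : Fin n → Fin n → ℝ≥0 → ℝ≥0} {ρ : ℝ≥0} {v : Fin n → ℝ≥0} {i : Fin n}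

/-! ### Cyclic small-gain conditions -/

theorem foldr_comp_ofFn_mono {α : Type*} [Preorder α] {p : ℕ} {f g : Fin p → α → α}
    (hf : ∀ j, Monotone (f j)) (hfg : ∀ j, f j ≤ g j) :
    (List.ofFn f).foldr (fun g h => g ∘ h) id ≤ (List.ofFn g).foldr (fun g h => g ∘ h) id := by
  induction p with
  | zero => simp
  | succ p ih =>
    simp only [List.ofFn_succ, List.foldr_cons]
    exact fun s => (hf 0 (ih (fun j => hf j.succ) (fun j => hfg j.succ) s)).trans (hfg 0 _)

theorem le_foldr_comp_ofFn {α : Type*} [Preorder α] {p : ℕ} {f : Fin p → α → α}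
    (hf : ∀ j, Monotone (f j)) {s : ℕ → α} (hs : ∀ j : Fin p, s j ≤ f j (s (j + 1))) :
    s 0 ≤ (List.ofFn f).foldr (fun g h => g ∘ h) id (s p) := by
  induction p generalizing s with
  | zero => simp
  | succ p ih =>
    rw [List.ofFn_succ, List.foldr_cons]
    exact (hs 0).trans (hf 0 (ih (fun j => hf j.succ) (s := fun k => s (k + 1)) fun j => hs j.succ))

theorem finRotate_ne_self {p : ℕ} (hp : 2 ≤ p) (j : Fin p) : finRotate p j ≠ j :=
  Equiv.Perm.mem_support.1 (support_finRotate_of_le hp ▸ Finset.mem_univ j)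

theorem CyclicSmallGain.anti (h : CyclicSmallGain γ')
    (hγ : ∀ i j, j ≠ i → Monotone (γ i j)) (hle : ∀ i j, j ≠ i → γ i j ≤ γ' i j) :
    CyclicSmallGain γ := by
  intro p hp hpn c hc s hs
  have hne : ∀ j : Fin p, c (finRotate p j) ≠ c j := fun j => hc.ne (finRotate_ne_self hp j)
  exact (foldr_comp_ofFn_mono (fun j => hγ _ _ (hne j)) (fun j => hle _ _ (hne j)) s).trans_lt
    (h p hp hpn c hc s hs)

theorem CyclicSmallGain.of_dilation {ω : ℝ≥0} (hω : 1 ≤ ω)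
    (h : CyclicSmallGain fun i j s => ω * γ i j (ω * s)) (hγ : ∀ i j, j ≠ i → Monotone (γ i j)) :
    CyclicSmallGain γ :=
  h.anti hγ fun i j hij _ =>
    (hγ i j hij (le_mul_of_one_le_left' hω)).trans (le_mul_of_one_le_left' hω)

/-- At the levels `v`, the positive level of `i` is accounted for by the gain from `j`: the edges
along which a subsolution of the gain inequalities is traced back to its source. -/
structure IsDrivenBy (γ : Fin n → Fin n → ℝ≥0 → ℝ≥0) (v : Fin n → ℝ≥0) (i j : Fin n) : Prop where
  ne : j ≠ i
  pos : 0 < v i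
  le : v i ≤ γ i j (v j)

theorem le_cycleGain_of_isDrivenBy (hγ : ∀ i j, j ≠ i → Monotone (γ i j)) {g : Fin n → Fin n}
    {p : ℕ} (hp : Function.IsPeriodicPt g p i)
    (hg : ∀ k < p, IsDrivenBy γ v (g^[k] i) (g^[k + 1] i)) :
    v i ≤ cycleGain γ (fun j : Fin p => g^[j] i) (v i) := by
  have hrotate : ∀ j : Fin p, g^[finRotate p j] i = g^[j + 1] i := by
    intro j
    obtain _ | p := p
    · exact j.elim0
    · rw [finRotate_apply, Fin.val_add, ← hp.iterate_mod_apply (j + 1)]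
      simp
  have hle := le_foldr_comp_ofFn (f := fun j : Fin p => γ (g^[j] i) (g^[finRotate p j] i))
    (s := fun k => v (g^[k] i)) (fun j => hγ _ _ (by rw [hrotate]; exact (hg j j.2).ne))
    (fun j => by rw [hrotate]; exact (hg j j.2).le)
  rwa [hp] at hle

theorem exists_isPeriodicPt_iterate {α : Type*} [Fintype α] (g : α → α) (a : α) :
    ∃ k p, 0 < p ∧ k + p ≤ Fintype.card α ∧ Function.IsPeriodicPt g p (g^[k] a) := by
  obtain ⟨k, l, hne, hkl⟩ := Fintype.exists_ne_map_eq_of_card_lt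
    (fun k : Fin (Fintype.card α + 1) => g^[k] a) (by simp)
  wlog hlt : k < l generalizing k l
  · exact this l k hne.symm hkl.symm (hne.lt_or_gt.resolve_left hlt)
  refine ⟨k, l - k, by omega, by omega, ?_⟩
  rw [Function.IsPeriodicPt, Function.IsFixedPt, ← Function.iterate_add_apply,
    Nat.sub_add_cancel (Fin.le_def.1 hlt.le)]
  exact hkl.symm

theorem CyclicSmallGain.not_isDrivenBy (h : CyclicSmallGain γ)
    (hγ : ∀ i j, j ≠ i → Monotone (γ i j)) (g : Fin n → Fin n) :
    ¬ ∀ k < n, IsDrivenBy γ v (g^[k] i) (g^[k + 1] i) := by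
  intro hdriven
  obtain ⟨k, l, hl, hkl, hperiodic⟩ := exists_isPeriodicPt_iterate g i
  rw [Fintype.card_fin] at hkl
  set a := g^[k] i
  set p := Function.minimalPeriod g a
  have hpl : p ≤ l := hperiodic.minimalPeriod_le hl
  have ha : ∀ j < p, IsDrivenBy γ v (g^[j] a) (g^[j + 1] a) := by
    intro j hj
    simpa only [a, ← Function.iterate_add_apply, add_right_comm] using hdriven (j + k) (by omega)
  have hp0 : 0 < p := hperiodic.minimalPeriod_pos hl
  have hp1 : p ≠ 1 := fun h1 =>
    (ha 0 hp0).ne (Function.minimalPeriod_eq_one_iff_isFixedPt.1 h1)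
  have hinj : Function.Injective fun j : Fin p => g^[j] a := fun j j' hj =>
    Fin.ext (Function.iterate_injOn_Iio_minimalPeriod j.2 j'.2 hj)
  exact (h p (by omega) (by omega) _ hinj _ (ha 0 hp0).pos).not_ge
    (le_cycleGain_of_isDrivenBy hγ (Function.isPeriodicPt_minimalPeriod g a) ha)

/-- The gain operator `v ↦ (max_{j ≠ i} γ i j (v j))_i`: the bound for the best replies when the
deviations of the players are bounded by `v`. -/
def maxGain (γ : Fin n → Fin n → ℝ≥0 → ℝ≥0) (v : Fin n → ℝ≥0) (i : Fin n) : ℝ≥0 :=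
  Finset.univ.sup fun j : {j : Fin n // j ≠ i} => γ i j (v j)

theorem le_maxGain {j : Fin n} (hij : j ≠ i) : γ i j (v j) ≤ maxGain γ v i :=
  Finset.le_sup (f := fun j : {j : Fin n // j ≠ i} => γ i j (v j)) (Finset.mem_univ ⟨j, hij⟩)

theorem continuous_maxGain (hγ : ∀ i j, j ≠ i → Continuous (γ i j)) :
    Continuous fun v => maxGain γ v i :=
  Continuous.finset_sup_apply fun (j : {j : Fin n // j ≠ i}) _ =>
    (hγ i j j.2).comp (continuous_apply _)

theorem exists_isDrivenBy (h : v i ≤ ρ ⊔ maxGain γ v i) (hρ : ρ < v i) :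
    ∃ j, IsDrivenBy γ v i j := by
  have hle : v i ≤ maxGain γ v i := (le_sup_iff.1 h).resolve_left hρ.not_ge
  obtain ⟨j, -, hj⟩ := (Finset.le_sup_iff (pos_of_gt hρ)).1 hle
  exact ⟨j, j.2, pos_of_gt hρ, hj⟩

/-- The bound for the subsolutions `v ≤ max ρ (maxGain γ v)`. The number `n` of iterations is what
it takes for a chain of `IsDrivenBy` edges to run into a cycle. -/
def gainBound (γ : Fin n → Fin n → ℝ≥0 → ℝ≥0) (ρ : ℝ≥0) : Fin n → ℝ≥0 :=
  (fun v i => ρ ⊔ maxGain γ v i)^[n] 0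

theorem continuous_gainBound (hγ : ∀ i j, j ≠ i → Continuous (γ i j)) :
    Continuous (gainBound γ) := by
  have hiterate : ∀ l : ℕ, Continuous fun ρ => (fun v i => ρ ⊔ maxGain γ v i)^[l] 0 := by
    intro l
    induction l with
    | zero => exact continuous_const
    | succ l ih =>
      simp only [Function.iterate_succ_apply']
      exact continuous_pi fun i => continuous_id.sup ((continuous_maxGain hγ).comp ih)
  exact hiterate n

theorem gainBound_zero (hγ : ∀ i j, j ≠ i → γ i j 0 = 0) : gainBound γ 0 = 0 :=
  Function.iterate_fixed
    (funext fun i => le_bot_iff.1 <| sup_le le_rfl <|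
      Finset.sup_le fun (j : {j : Fin n // j ≠ i}) _ => (hγ i j j.2).le) n

theorem exists_sum_gainBound_lt (hγ : ∀ i j, j ≠ i → IsClassN (γ i j)) {ε : ℝ} (hε : 0 < ε) :
    ∃ δ : ℝ≥0, 0 < δ ∧ ∑ i, (gainBound γ δ i : ℝ) < ε := by
  have hcont : Continuous fun ρ => ∑ i, (gainBound γ ρ i : ℝ) :=
    continuous_finsetSum _ fun i _ => NNReal.continuous_coe.comp <|
      (continuous_apply i).comp (continuous_gainBound fun i j hij => (hγ i j hij).continuous)
  have hzero : ∑ i, (gainBound γ 0 i : ℝ) < ε := by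
    simpa [gainBound_zero fun i j hij => (hγ i j hij).map_zero] using hε
  have hnear : ∀ᶠ ρ in nhdsWithin (0 : ℝ≥0) (Set.Ioi 0), ∑ i, (gainBound γ ρ i : ℝ) < ε :=
    (hcont.continuousAt.eventually_lt continuousAt_const hzero).filter_mono nhdsWithin_le_nhds
  exact (eventually_mem_nhdsWithin.and hnear).exists

theorem isDrivenBy_iterate_of_lt (hγ : ∀ i j, j ≠ i → Monotone (γ i j)) {g : Fin n → Fin n}
    (hg : ∀ i, ρ < v i → IsDrivenBy γ v i (g i)) {l : ℕ}
    (hi : (fun v i => ρ ⊔ maxGain γ v i)^[l] 0 i < v i) :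
    ∀ k < l, IsDrivenBy γ v (g^[k] i) (g^[k + 1] i) := by
  induction l generalizing i with
  | zero => exact fun k hk => absurd hk k.not_lt_zero
  | succ l ih =>
    rw [Function.iterate_succ_apply'] at hi
    have hdriven : IsDrivenBy γ v i (g i) := hg i (le_sup_left.trans_lt hi)
    have hnext : (fun v i => ρ ⊔ maxGain γ v i)^[l] 0 (g i) < v (g i) := by
      by_contra! hle
      exact hi.not_ge <| hdriven.le.trans <| (hγ _ _ hdriven.ne hle).trans <|
        (le_maxGain hdriven.ne).trans le_sup_right
    rintro (_ | k) hk
    · exact hdriven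
    · exact ih hnext k (by omega)

theorem CyclicSmallGain.le_gainBound (h : CyclicSmallGain γ)
    (hγ : ∀ i j, j ≠ i → Monotone (γ i j)) (hv : ∀ i, v i ≤ ρ ⊔ maxGain γ v i) :
    v ≤ gainBound γ ρ := by
  intro i
  by_contra! hi
  have hdriver : ∀ i, ∃ j, ρ < v i → IsDrivenBy γ v i j := fun i => by
    by_cases hρ : ρ < v i
    · exact (exists_isDrivenBy (hv i) hρ).imp fun j hj _ => hj
    · exact ⟨i, fun h => absurd h hρ⟩
  choose g hg using hdriver
  exact h.not_isDrivenBy hγ g (isDrivenBy_iterate_of_lt hγ hg hi)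

/-- The bound for the next action of player `i`: a mean, with weight at most `Θ` on the own past,
of the own past (bounded by `c i`) and the best reply (bounded by `maxGain γ c i`). The truncated
subtraction of `ℝ≥0` is intended: if `c i` is below the gain, the largest mean is the gain. -/
def dampedGain (γ : Fin n → Fin n → ℝ≥0 → ℝ≥0) (Θ : ℝ≥0) (c : Fin n → ℝ≥0) (i : Fin n) : ℝ≥0 :=
  maxGain γ c i + Θ * (c i - maxGain γ c i)

theorem continuous_dampedGain (hγ : ∀ i j, j ≠ i → Continuous (γ i j)) (Θ : ℝ≥0) :
    Continuous fun c => dampedGain γ Θ c i :=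
  (continuous_maxGain hγ).add
    (continuous_const.mul ((continuous_apply i).sub (continuous_maxGain hγ)))

theorem le_of_le_add_mul_tsub {a g Θ : ℝ≥0} (hΘ : Θ < 1) (h : a ≤ g + Θ * (a - g)) : a ≤ g := by
  by_contra! hga
  have hexcess : 0 < a - g := tsub_pos_of_lt hga
  have hle : a - g ≤ Θ * (a - g) := tsub_le_iff_left.2 h
  exact (mul_lt_of_lt_one_left hexcess hΘ).not_ge hle

theorem le_sup_maxGain_of_le_sup_dampedGain {Θ : ℝ≥0} (hΘ : Θ < 1)
    (h : v i ≤ ρ ⊔ dampedGain γ Θ v i) : v i ≤ ρ ⊔ maxGain γ v i :=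
  le_sup_iff.2 ((le_sup_iff.1 h).imp_right (le_of_le_add_mul_tsub hΘ))

/-- Comparison principle, for sets `B i` of upper bounds that can be improved by `hstep`: their
infima `sInf (B i)`, which need not be bounds themselves, form a subsolution. -/
theorem CyclicSmallGain.mem_of_gainBound_lt (h : CyclicSmallGain γ)
    (hγ : ∀ i j, j ≠ i → IsClassN (γ i j)) {Θ : ℝ≥0} (hΘ : Θ < 1) {B : Fin n → Set ℝ≥0}
    (hupper : ∀ i, IsUpperSet (B i)) (hne : ∀ i, (B i).Nonempty)
    (hstep : ∀ c : Fin n → ℝ≥0, (∀ i, c i ∈ B i) → ∀ i, ρ ⊔ dampedGain γ Θ c i ∈ B i)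
    {b : ℝ≥0} (hb : gainBound γ ρ i < b) : b ∈ B i := by
  let L : Fin n → ℝ≥0 := fun i => sInf (B i)
  have hmem : ∀ i b, L i < b → b ∈ B i := fun i b hb => by
    obtain ⟨b', hb', hlt⟩ := exists_lt_of_csInf_lt (hne i) hb
    exact hupper i hlt.le hb'
  have happrox : ∀ i, ∀ ε > 0, L i ≤ ρ ⊔ dampedGain γ Θ (fun j => L j + ε) i := fun i ε hε =>
    csInf_le (OrderBot.bddBelow _) (hstep _ (fun j => hmem j _ (lt_add_of_pos_right _ hε)) i)
  have hsub : ∀ i, L i ≤ ρ ⊔ dampedGain γ Θ L i := by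
    intro i
    have hcont : Continuous fun ε : ℝ≥0 => ρ ⊔ dampedGain γ Θ (fun j => L j + ε) i :=
      continuous_const.sup <|
        (continuous_dampedGain (fun i j hij => (hγ i j hij).continuous) Θ).comp
          (continuous_pi fun j => continuous_const.add continuous_id)
    have hlim := (hcont.tendsto 0).mono_left (nhdsWithin_le_nhds (s := Set.Ioi 0))
    simp only [add_zero] at hlim
    exact ge_of_tendsto hlim (eventually_nhdsWithin_of_forall (happrox i))
  refine hmem i b (lt_of_le_of_lt (h.le_gainBound (fun i j hij => (hγ i j hij).monotone) ?_ i) hb)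
  exact fun i => le_sup_maxGain_of_le_sup_dampedGain hΘ (hsub i)

end Gains

section DelayInequalities

open Filter

/-! ### Delay inequalities -/

variable {n : ℕ} {γ : Fin n → Fin n → ℝ≥0 → ℝ≥0} {Θ : ℝ≥0} {T : ℝ}

/-- The delay inequality for the deviations `v` of the players: bounds `c` for the history on
`[t - T, t]` of a positive time `t` yield the bounds `dampedGain γ Θ c` at time `t`. -/
def IsDamped (γ : Fin n → Fin n → ℝ≥0 → ℝ≥0) (Θ : ℝ≥0) (T : ℝ) (v : ℝ → Fin n → ℝ≥0) : Prop :=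
  ∀ t > 0, ∀ c : Fin n → ℝ≥0, (∀ s ∈ Set.Icc (t - T) t, ∀ j, v s j ≤ c j) →
    ∀ i, v t i ≤ dampedGain γ Θ c i

theorem IsDamped.le_gainBound {v : ℝ → Fin n → ℝ≥0} (hv : IsDamped γ Θ T v)
    (h : CyclicSmallGain γ) (hγ : ∀ i j, j ≠ i → IsClassN (γ i j)) (hΘ : Θ < 1) {ρ : ℝ≥0}
    (hinit : ∀ s ∈ Set.Icc (-T) 0, ∀ i, v s i ≤ ρ) {t : ℝ}
    (hbdd : ∃ M, ∀ s ∈ Set.Icc (-T) t, ∀ i, v s i ≤ M) {s : ℝ} (hs : s ∈ Set.Icc (-T) t)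
    (i : Fin n) : v s i ≤ gainBound γ ρ i := by
  refine le_of_forall_gt_imp_ge_of_dense fun b hb => ?_
  have hmem := h.mem_of_gainBound_lt hγ hΘ (B := fun i => {b | ∀ s ∈ Set.Icc (-T) t, v s i ≤ b})
    (fun i b b' hle hb s hs => (hb s hs).trans hle)
    (fun i => hbdd.imp fun M hM s hs => hM s hs i) ?_ hb
  · exact hmem s hs
  · intro c hc i s hs
    rcases le_or_gt s 0 with hs0 | hs0
    · exact (hinit s ⟨hs.1, hs0⟩ i).trans le_sup_left
    · refine (hv s hs0 c (fun s' hs' j => hc j s' ⟨?_, hs'.2.trans hs.2⟩) i).trans le_sup_right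
      linarith [hs'.1]

theorem eventually_forall_ge_sub {p : ℝ → Prop} (h : ∀ᶠ t in atTop, p t) (T : ℝ) :
    ∀ᶠ t in atTop, ∀ s ≥ t - T, p s :=
  (tendsto_atTop_add_const_right _ (-T) tendsto_id).eventually (eventually_forall_ge_atTop.2 h)

theorem CyclicSmallGain.eventually_le_of_isDamped (h : CyclicSmallGain γ)
    (hγ : ∀ i j, j ≠ i → IsClassN (γ i j)) (hΘ : Θ < 1) (T : ℝ) (M : Fin n → ℝ≥0) {b : ℝ≥0}
    (hb : 0 < b) (i : Fin n) :
    ∀ᶠ t in atTop, ∀ v, IsDamped γ Θ T v → (∀ s ≥ 0, ∀ j, v s j ≤ M j) → v t i ≤ b := by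
  let B : Fin n → Set ℝ≥0 := fun i =>
    {b | ∀ᶠ t in atTop, ∀ v, IsDamped γ Θ T v → (∀ s ≥ 0, ∀ j, v s j ≤ M j) → v t i ≤ b}
  refine h.mem_of_gainBound_lt (ρ := 0) hγ hΘ (B := B) ?_ ?_ ?_
    (by rwa [gainBound_zero fun i j hij => (hγ i j hij).map_zero])
  · exact fun i b b' hle hb => hb.mono fun t ht v hv hM => (ht v hv hM).trans hle
  · exact fun i => ⟨M i, (eventually_ge_atTop 0).mono fun t ht v _ hM => hM t ht i⟩
  · intro c hc i
    filter_upwards [eventually_forall_ge_sub (eventually_all.2 hc) T, eventually_gt_atTop 0]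
      with t hpast ht v hv hM
    exact (hv t ht c (fun s hs j => hpast s hs.1 j v hv hM) i).trans le_sup_right

end DelayInequalities

section Norms

/-! ### Projections and norms -/

theorem norm_projOn_sub_le {E : Type*} [NormedAddCommGroup E] [InnerProductSpace ℝ E]
    [ProperSpace E] {U : Set E} (hc : IsClosed U) (hU : Convex ℝ U) (hne : U.Nonempty) {q : E}
    (hq : q ∈ U) (y : E) : ‖(projOn hc hne y : E) - q‖ ≤ ‖y - q‖ := by
  set p : E := (projOn hc hne y : E)
  have hmin : ‖y - p‖ = ⨅ w : U, ‖y - w‖ := by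
    simpa only [dist_eq_norm, Metric.infDist_eq_iInf] using (dist_projOn hc hne y).symm
  have hobtuse : inner ℝ (y - p) (q - p) ≤ 0 :=
    (norm_eq_iInf_iff_real_inner_le_zero hU (projOn hc hne y).2).1 hmin q hq
  have hsq : ‖p - q‖ * ‖p - q‖ ≤ ‖y - q‖ * ‖p - q‖ :=
    calc ‖p - q‖ * ‖p - q‖ = inner ℝ (y - q) (p - q) + inner ℝ (y - p) (q - p) := by
          rw [← real_inner_self_eq_norm_mul_norm, ← neg_sub p q, inner_neg_right, ← sub_eq_add_neg,
            ← inner_sub_left, sub_sub_sub_cancel_left]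
      _ ≤ inner ℝ (y - q) (p - q) := add_le_of_nonpos_right hobtuse
      _ ≤ ‖y - q‖ * ‖p - q‖ := real_inner_le_norm _ _
  rcases (norm_nonneg (p - q)).eq_or_lt with h0 | hpos
  · exact h0 ▸ norm_nonneg _
  · exact le_of_mul_le_mul_right hsq hpos

theorem norm_convexCombination_le {E : Type*} [NormedAddCommGroup E] [NormedSpace ℝ E] {a b : E}
    {θ Θ : ℝ} (hθ : θ ∈ Set.Icc 0 Θ) (hΘ : Θ ≤ 1) {c g : ℝ≥0} (ha : ‖a‖ ≤ c) (hb : ‖b‖ ≤ g) :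
    ‖θ • a + (1 - θ) • b‖ ≤ (g + Θ.toNNReal * (c - g) : ℝ≥0) := by
  have hθ0 : 0 ≤ θ := hθ.1
  have hθ1 : 0 ≤ 1 - θ := sub_nonneg.2 (hθ.2.trans hΘ)
  calc ‖θ • a + (1 - θ) • b‖ ≤ θ * ‖a‖ + (1 - θ) * ‖b‖ := by
        simpa only [norm_smul, Real.norm_of_nonneg hθ.1, Real.norm_of_nonneg hθ1]
          using norm_add_le (θ • a) ((1 - θ) • b)
    _ ≤ θ * c + (1 - θ) * g := by gcongr
    _ = g + θ * (c - g) := by ring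
    _ ≤ g + θ * (c - g : ℝ≥0) := by gcongr; exact le_max_left _ _
    _ ≤ g + Θ.toNNReal * (c - g : ℝ≥0) := by
        gcongr
        exact hθ.2.trans (Real.le_coe_toNNReal Θ)
    _ = (g + Θ.toNNReal * (c - g) : ℝ≥0) := by rw [NNReal.coe_add, NNReal.coe_mul]

theorem norm_piLp_le_sum {ι : Type*} [Fintype ι] {E : ι → Type*} [∀ i, SeminormedAddCommGroup (E i)]
    {p : ℝ≥0∞} [Fact (1 ≤ p)] (x : PiLp p E) : ‖x‖ ≤ ∑ i, ‖x i‖ := by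
  classical
  have hsum : ∑ i, PiLp.single p i (x i) = x := by
    simp only [PiLp.single, ← WithLp.toLp_sum, Finset.univ_sum_single]
  calc ‖x‖ = ‖∑ i, PiLp.single p i (x i)‖ := by rw [hsum]
    _ ≤ ∑ i, ‖x i‖ := norm_sum_le_of_le _ fun i _ => (PiLp.norm_single _ _ _ _).le

theorem supNormOn_nonneg {E : Type*} [SeminormedAddGroup E] (x : ℝ → E) (a b : ℝ) :
    0 ≤ supNormOn x a b :=
  Real.iSup_nonneg fun _ => norm_nonneg _

theorem supNormOn_le {E : Type*} [Norm E] {x : ℝ → E} {a b c : ℝ} (hc : 0 ≤ c)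
    (h : ∀ s ∈ Set.Icc a b, ‖x s‖ ≤ c) : supNormOn x a b ≤ c :=
  Real.iSup_le (fun s => h s s.2) hc

theorem supNormOn_congr {E : Type*} [Norm E] {x y : ℝ → E} {a b : ℝ}
    (h : Set.EqOn x y (Set.Icc a b)) : supNormOn x a b = supNormOn y a b :=
  iSup_congr fun s => by rw [h s.2]

end Norms

section Causality

/-! ### Causality -/

theorem exists_fixedPoint_of_causal {α : Type*} {β : α → Type*} [∀ a, Nonempty (β a)]
    {R : α → α → Prop} (hR : WellFounded R) (F : (∀ a, β a) → ∀ a, β a)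
    (hF : ∀ x y a, (∀ b, R b a → x b = y b) → F x a = F y a) : ∃ x, F x = x := by
  classical
  let step : ∀ a, (∀ b, R b a → β b) → β a := fun a past =>
    F (fun b => if h : R b a then past b h else Classical.arbitrary _) a
  refine ⟨hR.fix step, funext fun a => ?_⟩
  rw [hR.fix_eq step a]
  exact hF _ _ a fun b hb => by simp only [step, dif_pos hb]

/-- Player `i` has a rational-consistent expectation toward `j`: it depends on the present of `j`,
whereas a consistent backward-looking expectation only depends on the past before `t - r`. -/
def IsRationalToward {ι : Type*} {m : ℕ} (J : Fin m → Set ι) (i j : ι) : Prop :=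
  ∃ a b : Fin m, a < b ∧ i ∈ J a ∧ j ∈ J b

theorem wellFounded_isRationalToward {ι : Type*} [Finite ι] {m : ℕ} {J : Fin m → Set ι}
    (hJ : ∀ a b, a ≠ b → Disjoint (J a) (J b)) : WellFounded fun j i => IsRationalToward J i j := by
  have hindex : ∀ {i a b}, i ∈ J a → i ∈ J b → a = b := fun ha hb =>
    by_contra fun hne => Set.disjoint_left.1 (hJ _ _ hne) ha hb
  have : Std.Irrefl fun j i => IsRationalToward J i j :=
    ⟨fun i ⟨a, b, hab, ha, hb⟩ => hab.ne (hindex ha hb)⟩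
  have : IsTrans ι fun j i => IsRationalToward J i j :=
    ⟨fun k j i ⟨b', c, hbc, hj', hk⟩ ⟨a, b, hab, hi, hj⟩ =>
      ⟨a, c, hab.trans (hindex hj hj' ▸ hbc), hi, hk⟩⟩
  exact Finite.wellFounded_of_trans_of_irrefl _

variable {ι : Type*} {m : ℕ} {J : Fin m → Set ι} {r s t : ℝ} {i j : ι}

/-- The order in which a solution is determined: `(s, j)` precedes `(t, i)` if `s` lies in an
earlier one of the intervals `(k r, (k + 1) r]` than `t`, or in the same one with `i` rational
toward `j`. -/
def Precedes (J : Fin m → Set ι) (r : ℝ) : ℝ × ι → ℝ × ι → Prop :=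
  InvImage (Prod.Lex (· < ·) fun j i => IsRationalToward J i j) fun p => (⌈p.1 / r⌉₊, p.2)

theorem wellFounded_precedes (hJ : WellFounded fun j i => IsRationalToward J i j) (r : ℝ) :
    WellFounded (Precedes J r) :=
  InvImage.wf _ (wellFounded_lt.prod_lex hJ)

theorem precedes_of_le_sub (hr : 0 < r) (ht : 0 < t) (hst : s ≤ t - r) :
    Precedes J r (s, j) (t, i) := by
  have hle : s / r ≤ t / r - 1 := by
    rw [div_sub_one hr.ne']
    exact div_le_div_of_nonneg_right hst hr.le
  have hceil := Nat.ceil_mono hle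
  rw [Nat.ceil_sub_one] at hceil
  exact Prod.Lex.left _ _ (hceil.trans_lt (Nat.sub_lt (Nat.ceil_pos.2 (div_pos ht hr)) one_pos))

theorem precedes_of_isRationalToward (hr : 0 < r) (hst : s ≤ t) (hij : IsRationalToward J i j) :
    Precedes J r (s, j) (t, i) := by
  have hceil : ⌈s / r⌉₊ ≤ ⌈t / r⌉₊ := Nat.ceil_mono (div_le_div_of_nonneg_right hst hr.le)
  exact Prod.lex_iff.2 (hceil.lt_or_eq.imp_right fun heq => ⟨heq, hij⟩)

theorem exists_bound_of_causal [Finite ι] (hJ : WellFounded fun j i => IsRationalToward J i j)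
    (hr : 0 < r) {T : ℝ} {v : ℝ → ι → ℝ≥0} {ρ : ℝ≥0}
    (hinit : ∀ s ∈ Set.Icc (-T) 0, ∀ i, v s i ≤ ρ)
    (hstep : ∀ B : ℝ≥0, ∃ B' : ℝ≥0, ∀ t > 0, ∀ i,
      (∀ s ≥ -T, ∀ j, Precedes J r (s, j) (t, i) → v s j ≤ B) → v t i ≤ B') (t : ℝ) :
    ∃ M, ∀ s ∈ Set.Icc (-T) t, ∀ i, v s i ≤ M := by
  have hfinite : ∀ N : ℕ, (Set.Iic N ×ˢ (Set.univ : Set ι)).Finite := fun N =>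
    (Set.finite_Iic N).prod Set.finite_univ
  have hbound : ∀ p : ℕ × ι, ∀ᶠ B in Filter.atTop, ∀ s ≥ -T, ⌈s / r⌉₊ = p.1 → v s p.2 ≤ B := by
    intro p
    refine (wellFounded_lt.prod_lex hJ).induction (C := fun p => ∀ᶠ B in Filter.atTop,
      ∀ s ≥ -T, ⌈s / r⌉₊ = p.1 → v s p.2 ≤ B) p ?_
    rintro ⟨N, i⟩ ih
    have hpred : {p : ℕ × ι | Prod.Lex (· < ·) (fun j i => IsRationalToward J i j) p (N, i)} ⊆
        Set.Iic N ×ˢ Set.univ := fun p hp =>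
      ⟨(Prod.lex_iff.1 hp).elim le_of_lt fun h => h.1.le, trivial⟩
    obtain ⟨B, hB⟩ := ((Filter.eventually_all_finite ((hfinite N).subset hpred)).2 ih).exists
    obtain ⟨B', hB'⟩ := hstep B
    filter_upwards [Filter.eventually_ge_atTop (ρ ⊔ B')] with M hM
    rintro s hs rfl
    rcases le_or_gt s 0 with hs0 | hs0
    · exact (hinit s ⟨hs, hs0⟩ i).trans (le_sup_left.trans hM)
    · exact (hB' s hs0 i fun s' hs' j hp => hB _ hp s' hs' rfl).trans (le_sup_right.trans hM)
  obtain ⟨M, hM⟩ := ((Filter.eventually_all_finite (hfinite ⌈t / r⌉₊)).2 fun p _ => hbound p).exists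
  exact ⟨M, fun s hs i => hM (⌈s / r⌉₊, i)
    ⟨Nat.ceil_mono (div_le_div_of_nonneg_right hs.2 hr.le), trivial⟩ s hs.1 rfl⟩

end Causality

namespace StrategicGame

/-! ### Solutions of the uncertain system -/

variable {n : ℕ} {G : StrategicGame n} {q : (i : Fin n) → G.S i}
  {γ : Fin n → Fin n → ℝ≥0 → ℝ≥0} {m : ℕ} {J : Fin m → Set (Fin n)} {Θ r T : ℝ}
  {x₀ : G.State T} {u : G.Input Θ r T} {x y : ℝ → G.Profile}

/-- The `γ i j` are gains of the best reply mappings for the deviations from `q`. -/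
structure HasGains (G : StrategicGame n) (q : (i : Fin n) → G.S i)
    (γ : Fin n → Fin n → ℝ≥0 → ℝ≥0) : Prop where
  isClassN : ∀ i j, j ≠ i → IsClassN (γ i j)
  nnnorm_bestReply_le : ∀ (i : Fin n) (p : (j : Fin n) → G.S j),
    ‖(G.bestReply i (fun j => p j) : EuclideanSpace ℝ (Fin (G.k i))) - q i‖₊ ≤
      maxGain γ (fun j => ‖(p j : EuclideanSpace ℝ (Fin (G.k j))) - q j‖₊) i

theorem norm_proj_add_sub_le (i : Fin n) (y : EuclideanSpace ℝ (Fin (G.k i))) :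
    ‖(G.proj q i (q i + y) : EuclideanSpace ℝ (Fin (G.k i))) - q i‖ ≤ ‖y‖ := by
  simpa only [proj, add_sub_cancel_left] using
    norm_projOn_sub_le (G.isClosed_S i) (G.convex_S i) ⟨q i, (q i).2⟩ (q i).2 (q i + y)

theorem HasGains.nnnorm_bestReply_sub_le (hG : G.HasGains q γ) {i : Fin n}
    {e : (j : {j : Fin n // j ≠ i}) → G.S j} {c : Fin n → ℝ≥0}
    (he : ∀ j : {j : Fin n // j ≠ i}, ‖(e j : EuclideanSpace ℝ (Fin (G.k j))) - q j‖₊ ≤ c j) :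
    ‖(G.bestReply i e : EuclideanSpace ℝ (Fin (G.k i))) - q i‖₊ ≤ maxGain γ c i := by
  let p : (j : Fin n) → G.S j := fun j => if h : j ≠ i then e ⟨j, h⟩ else q j
  have hp : (fun j : {j : Fin n // j ≠ i} => p j) = e := funext fun j => dif_pos j.2
  have hpc : ∀ j : {j : Fin n // j ≠ i}, ‖(p j : EuclideanSpace ℝ (Fin (G.k j))) - q j‖₊ ≤ c j :=
    fun j => by rw [show p j = e j from dif_pos j.2]; exact he j
  calc ‖(G.bestReply i e : EuclideanSpace ℝ (Fin (G.k i))) - q i‖₊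
      ≤ maxGain γ (fun j => ‖(p j : EuclideanSpace ℝ (Fin (G.k j))) - q j‖₊) i :=
        hp ▸ hG.nnnorm_bestReply_le i p
    _ ≤ maxGain γ c i := Finset.sup_mono_fun fun j _ =>
        (hG.isClassN i j j.2).monotone (hpc j)

theorem expSize_nonneg (J : Fin m → Set (Fin n)) (r T : ℝ) (x : ℝ → G.Profile) (i j : Fin n)
    (t : ℝ) : 0 ≤ G.expSize J r T x i j t := by
  unfold expSize
  split_ifs <;> exact supNormOn_nonneg _ _ _

theorem expSize_le (hr : 0 < r) {i j : Fin n} {t : ℝ} (ht : 0 < t) {c : ℝ} (hc : 0 ≤ c)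
    (h : ∀ s ∈ Set.Icc (t - T) t, Precedes J r (s, j) (t, i) → ‖x s j‖ ≤ c) :
    G.expSize J r T x i j t ≤ c := by
  unfold expSize
  split_ifs with hij
  · exact supNormOn_le hc fun s hs => h s hs (precedes_of_isRationalToward hr hs.2 hij)
  · exact supNormOn_le hc fun s hs =>
      h s ⟨hs.1, by linarith [hs.2]⟩ (precedes_of_le_sub hr ht hs.2)

theorem expSize_congr (hr : 0 < r) {i j : Fin n} {t : ℝ} (ht : 0 < t)
    (h : ∀ s ∈ Set.Icc (t - T) t, Precedes J r (s, j) (t, i) → x s j = y s j) :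
    G.expSize J r T x i j t = G.expSize J r T y i j t := by
  unfold expSize
  split_ifs with hij
  · exact supNormOn_congr fun s hs => h s hs (precedes_of_isRationalToward hr hs.2 hij)
  · exact supNormOn_congr fun s hs =>
      h s ⟨hs.1, by linarith [hs.2]⟩ (precedes_of_le_sub hr ht hs.2)

theorem sub_delay_mem_Icc (hr : 0 < r) (u : G.Input Θ r T) (i : Fin n) (t : ℝ≥0) :
    (t - u.τ i t : ℝ) ∈ Set.Icc (t - T : ℝ) t :=
  ⟨sub_le_sub_left (u.τ i t).2.2 _, sub_le_self _ (hr.le.trans (u.τ i t).2.1)⟩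

theorem precedes_sub_delay (hr : 0 < r) (u : G.Input Θ r T) (i : Fin n) {t : ℝ≥0} (ht : 0 < t) :
    Precedes J r (t - u.τ i t, i) (t, i) :=
  precedes_of_le_sub hr ht (sub_le_sub_left (u.τ i t).2.1 _)

theorem rhs_congr (hr : 0 < r) {i : Fin n} {t : ℝ≥0} (ht : 0 < t)
    (h : ∀ s ∈ Set.Icc (t - T : ℝ) t, ∀ j, Precedes J r (s, j) (t, i) → x s j = y s j) :
    G.rhs J q u x i t = G.rhs J q u y i t := by
  have hpast : x (t - u.τ i t) i = y (t - u.τ i t) i :=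
    h _ (sub_delay_mem_Icc hr u i t) i (precedes_sub_delay hr u i ht)
  have hexp : ∀ j, G.expSize J r T x i j t = G.expSize J r T y i j t := fun j =>
    expSize_congr hr ht fun s hs => h s hs j
  simp only [rhs, hpast, hexp]

theorem HasGains.nnnorm_rhs_le (hG : G.HasGains q γ) (hΘ : Θ ≤ 1) (hr : 0 < r) {i : Fin n}
    {t : ℝ≥0} (ht : 0 < t) {c : Fin n → ℝ≥0}
    (h : ∀ s ∈ Set.Icc (t - T : ℝ) t, ∀ j, Precedes J r (s, j) (t, i) → ‖x s j‖₊ ≤ c j) :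
    ‖G.rhs J q u x i t‖₊ ≤ dampedGain γ Θ.toNNReal c i := by
  refine norm_convexCombination_le (u.θ i t).2 hΘ ?_ (hG.nnnorm_bestReply_sub_le fun j => ?_)
  · rw [add_comm]
    exact (norm_proj_add_sub_le i _).trans
      (h _ (sub_delay_mem_Icc hr u i t) i (precedes_sub_delay hr u i ht))
  · have hexp : G.expSize J r T x i j t ≤ c j := expSize_le hr ht (c j).2 fun s hs => h s hs j
    have hd : ‖(u.d i j t : EuclideanSpace ℝ (Fin (G.k j)))‖ ≤ 1 :=
      mem_closedBall_zero_iff.1 (u.d i j t).2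
    refine (norm_proj_add_sub_le (j : Fin n) _).trans ?_
    rw [norm_smul, Real.norm_of_nonneg (expSize_nonneg _ _ _ _ _ _ _)]
    exact (mul_le_of_le_one_right (expSize_nonneg _ _ _ _ _ _ _) hd).trans hexp

/-- `x` solves the uncertain system on `[-T, ∞)` with initial condition `x₀` on `[-T, 0]` and
input `u`. -/
structure IsSolution (J : Fin m → Set (Fin n)) (q : (i : Fin n) → G.S i) (x₀ : G.State T)
    (u : G.Input Θ r T) (x : ℝ → G.Profile) : Prop where
  initial : ∀ s : Set.Icc (-T) (0 : ℝ), x s = x₀ s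
  eq_rhs : ∀ t : ℝ≥0, 0 < t → ∀ i, x t i = G.rhs J q u x i t

theorem exists_isSolution (hJ : WellFounded fun j i => IsRationalToward J i j) (hr : 0 < r)
    (q : (i : Fin n) → G.S i) (x₀ : G.State T) (u : G.Input Θ r T) :
    ∃ x, IsSolution J q x₀ u x := by
  let init : ℝ → G.Profile := Function.extend Subtype.val x₀ 0
  let toProfile : (∀ p : ℝ × Fin n, EuclideanSpace ℝ (Fin (G.k p.2))) → ℝ → G.Profile :=
    fun z t => WithLp.toLp 2 fun i => z (t, i)
  obtain ⟨z, hz⟩ := exists_fixedPoint_of_causal (wellFounded_precedes hJ r)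
    (fun (z : ∀ p : ℝ × Fin n, EuclideanSpace ℝ (Fin (G.k p.2))) p =>
      if p.1 ≤ 0 then init p.1 p.2 else G.rhs J q u (toProfile z) p.2 p.1.toNNReal) <| by
    rintro z w ⟨t, i⟩ hzw
    dsimp only
    split_ifs with ht
    · rfl
    · lift t to ℝ≥0 using (not_le.1 ht).le
      rw [Real.toNNReal_coe]
      exact rhs_congr hr (NNReal.coe_pos.1 (not_le.1 ht)) fun s _ j hp => hzw (s, j) hp
  refine ⟨toProfile z, fun s => PiLp.ext fun i => ?_, fun t ht i => ?_⟩
  · exact (congr_fun hz (s, i)).symm.trans <|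
      (if_pos s.2.2).trans (congrArg (· i) (Subtype.val_injective.extend_apply x₀ 0 s))
  · refine (congr_fun hz (t, i)).symm.trans ((if_neg (not_le.2 (NNReal.coe_pos.2 ht))).trans ?_)
    rw [Real.toNNReal_coe]

namespace IsSolution

theorem unique (hJ : WellFounded fun j i => IsRationalToward J i j) (hr : 0 < r)
    (hx : IsSolution J q x₀ u x) (hy : IsSolution J q x₀ u y) :
    Set.EqOn x y (Set.Ici (-T)) := by
  have heq : ∀ p : ℝ × Fin n, -T ≤ p.1 → x p.1 p.2 = y p.1 p.2 := by
    intro p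
    refine (wellFounded_precedes hJ r).induction (C := fun p => -T ≤ p.1 → x p.1 p.2 = y p.1 p.2)
      p ?_
    rintro ⟨t, i⟩ ih hT
    dsimp only at hT ⊢
    rcases le_or_gt t 0 with ht | ht
    · rw [hx.initial ⟨t, hT, ht⟩, hy.initial ⟨t, hT, ht⟩]
    · lift t to ℝ≥0 using ht.le
      rw [hx.eq_rhs t ht i, hy.eq_rhs t ht i]
      exact rhs_congr hr ht fun s hs j hp => ih (s, j) hp (by linarith [hs.1])
  exact fun t ht => PiLp.ext fun i => heq (t, i) ht

theorem nnnorm_initial_le (hx : IsSolution J q x₀ u x) {s : ℝ} (hs : s ∈ Set.Icc (-T) 0)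
    (i : Fin n) : ‖x s i‖₊ ≤ ‖x₀‖₊ := by
  rw [hx.initial ⟨s, hs⟩]
  exact (PiLp.norm_apply_le _ _).trans (lp.norm_apply_le_norm ENNReal.top_ne_zero x₀ _)

theorem exists_bound (hJ : WellFounded fun j i => IsRationalToward J i j) (hG : G.HasGains q γ)
    (hΘ : Θ ≤ 1) (hr : 0 < r) (hx : IsSolution J q x₀ u x) (t : ℝ) :
    ∃ M, ∀ s ∈ Set.Icc (-T) t, ∀ i, ‖x s i‖₊ ≤ M := by
  refine exists_bound_of_causal hJ hr (fun s hs => hx.nnnorm_initial_le hs) (fun B => ?_) t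
  refine ⟨Finset.univ.sup (dampedGain γ Θ.toNNReal fun _ => B), fun t ht i hB => ?_⟩
  lift t to ℝ≥0 using ht.le
  rw [hx.eq_rhs t ht i]
  exact (hG.nnnorm_rhs_le hΘ hr ht fun s hs j => hB s (by linarith [hs.1]) j).trans
    (Finset.le_sup (Finset.mem_univ i))

theorem isDamped (hG : G.HasGains q γ) (hΘ : Θ ≤ 1) (hr : 0 < r) (hx : IsSolution J q x₀ u x) :
    IsDamped γ Θ.toNNReal T fun t i => ‖x t i‖₊ := by
  intro t ht c hc i
  lift t to ℝ≥0 using ht.le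
  dsimp only
  rw [hx.eq_rhs t ht i]
  exact hG.nnnorm_rhs_le hΘ hr ht fun s hs j _ => hc s hs j

theorem nnnorm_le_gainBound (hJ : WellFounded fun j i => IsRationalToward J i j)
    (hG : G.HasGains q γ) (hcyc : CyclicSmallGain γ) (hΘ : Θ < 1) (hr : 0 < r)
    (hx : IsSolution J q x₀ u x) {ρ : ℝ≥0} (hρ : ‖x₀‖ ≤ ρ) {t : ℝ} (ht : -T ≤ t) (i : Fin n) :
    ‖x t i‖₊ ≤ gainBound γ ρ i :=
  (hx.isDamped hG hΘ.le hr).le_gainBound hcyc hG.isClassN (Real.toNNReal_lt_one.2 hΘ)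
    (fun _ hs i => (hx.nnnorm_initial_le hs i).trans hρ) (hx.exists_bound hJ hG hΘ.le hr t)
    ⟨ht, le_rfl⟩ i

end IsSolution

theorem eventually_nnnorm_le (hJ : WellFounded fun j i => IsRationalToward J i j)
    (hG : G.HasGains q γ) (hcyc : CyclicSmallGain γ) (hΘ : Θ < 1) (hr : 0 < r) (ρ : ℝ≥0)
    {b : ℝ≥0} (hb : 0 < b) :
    ∀ᶠ t in Filter.atTop, ∀ (x₀ : G.State T) (u : G.Input Θ r T) (x : ℝ → G.Profile),
      IsSolution J q x₀ u x → ‖x₀‖ ≤ ρ → ∀ i, ‖x t i‖₊ ≤ b := by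
  filter_upwards [Filter.eventually_all.2 <| hcyc.eventually_le_of_isDamped hG.isClassN
    (Real.toNNReal_lt_one.2 hΘ) T (gainBound γ ρ) hb] with t ht x₀ u x hx hρ i
  have hT : 0 ≤ T := hr.le.trans ((u.τ i 0).2.1.trans (u.τ i 0).2.2)
  exact ht i _ (hx.isDamped hG hΘ.le hr) fun s hs =>
    hx.nnnorm_le_gainBound hJ hG hcyc hΘ hr hρ (by linarith)

/-! ### Evolution of the state -/

theorem norm_profile_le {z : G.Profile} {c : Fin n → ℝ≥0} (hz : ∀ i, ‖z i‖₊ ≤ c i) :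
    ‖z‖ ≤ ∑ i, (c i : ℝ) :=
  (norm_piLp_le_sum z).trans (Finset.sum_le_sum fun i _ => hz i)

theorem norm_state_le {z : G.State T} {t : ℝ} (hz : ∀ s : Set.Icc (-T) (0 : ℝ), z s = x (t + s))
    {c : Fin n → ℝ≥0} (hc : ∀ s ≥ t - T, ∀ i, ‖x s i‖₊ ≤ c i) : ‖z‖ ≤ ∑ i, (c i : ℝ) := by
  refine lp.norm_le_of_forall_le (by positivity) fun s => ?_
  rw [hz s]
  exact norm_profile_le (hc _ (by linarith [s.2.1]))

theorem existsUnique_isTrajectory (hJ : WellFounded fun j i => IsRationalToward J i j)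
    (hG : G.HasGains q γ) (hΘ : Θ ≤ 1) (hr : 0 < r) (x₀ : G.State T) (u : G.Input Θ r T) :
    ∃! ξ : ℝ≥0 → G.State T, G.IsTrajectory J q Θ r T x₀ u ξ := by
  obtain ⟨x, hx⟩ := exists_isSolution hJ hr q x₀ u
  have hmem : ∀ t : ℝ≥0, Memℓp (fun s : Set.Icc (-T) (0 : ℝ) => x (t + s)) ∞ := by
    intro t
    obtain ⟨M, hM⟩ := hx.exists_bound hJ hG hΘ hr t
    refine memℓp_infty ⟨∑ _i : Fin n, (M : ℝ), ?_⟩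
    rintro _ ⟨s, rfl⟩
    exact norm_profile_le (hM _ ⟨by linarith [s.2.1, t.2], by linarith [s.2.2]⟩)
  refine ⟨fun t => ⟨fun s => x (t + s), hmem t⟩, ⟨x, hx.initial, hx.eq_rhs, fun _ _ => rfl⟩, ?_⟩
  rintro ξ ⟨y, hyinit, hyrhs, hξ⟩
  have hyx : Set.EqOn y x (Set.Ici (-T)) := IsSolution.unique hJ hr ⟨hyinit, hyrhs⟩ hx
  refine funext fun t => lp.ext (funext fun s => (hξ t s).trans (hyx ?_))
  exact s.2.1.trans (le_add_of_nonneg_left t.2)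

theorem IsTrajectory.norm_le (hJ : WellFounded fun j i => IsRationalToward J i j)
    (hG : G.HasGains q γ) (hcyc : CyclicSmallGain γ) (hΘ : Θ < 1) (hr : 0 < r)
    {ξ : ℝ≥0 → G.State T} (hξ : G.IsTrajectory J q Θ r T x₀ u ξ) {ρ : ℝ≥0} (hρ : ‖x₀‖ ≤ ρ)
    (t : ℝ≥0) : ‖ξ t‖ ≤ ∑ i, (gainBound γ ρ i : ℝ) := by
  obtain ⟨x, hinit, hrhs, hξ⟩ := hξ
  have hx : IsSolution J q x₀ u x := ⟨hinit, hrhs⟩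
  exact norm_state_le (hξ t) fun s hs =>
    hx.nnnorm_le_gainBound hJ hG hcyc hΘ hr hρ (by linarith [t.2])

theorem exists_forall_norm_isTrajectory_le
    (hJ : WellFounded fun j i => IsRationalToward J i j) (hG : G.HasGains q γ)
    (hcyc : CyclicSmallGain γ) (hΘ : Θ < 1) (hr : 0 < r) (ρ : ℝ≥0) {ε : ℝ} (hε : 0 < ε) :
    ∃ t₀ : ℝ≥0, ∀ (x₀ : G.State T) (u : G.Input Θ r T) (ξ : ℝ≥0 → G.State T),
      G.IsTrajectory J q Θ r T x₀ u ξ → ‖x₀‖ ≤ ρ → ∀ t, t₀ ≤ t → ‖ξ t‖ ≤ ε := by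
  obtain ⟨b, hb, hbε⟩ := exists_pos_mul_lt hε (n : ℝ)
  lift b to ℝ≥0 using hb.le
  obtain ⟨t₀, ht₀⟩ := Filter.eventually_atTop.1
    (eventually_forall_ge_sub (eventually_nnnorm_le (T := T) hJ hG hcyc hΘ hr ρ hb) T)
  refine ⟨t₀.toNNReal, ?_⟩
  rintro x₀ u ξ ⟨x, hinit, hrhs, hξ⟩ hρ t ht
  calc ‖ξ t‖ ≤ ∑ _i : Fin n, (b : ℝ) := norm_state_le (hξ t) fun s hs =>
        ht₀ t (Real.toNNReal_le_iff_le_coe.1 ht) s hs x₀ u x ⟨hinit, hrhs⟩ hρ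
    _ = n * b := by simp only [Finset.sum_const, Finset.card_univ, Fintype.card_fin, nsmul_eq_mul]
    _ ≤ ε := hbε.le

end StrategicGame

end

theorem theorem4p2_general {n : ℕ} (G : StrategicGame n) {q : (i : Fin n) → G.S i}
    {γ : Fin n → Fin n → ℝ≥0 → ℝ≥0} (hG : G.HasGains q γ) {m : ℕ} {J : Fin m → Set (Fin n)}
    (hJ : WellFounded fun j i => IsRationalToward J i j) {Θ r T : ℝ} (hΘ : Θ < 1) (hr : 0 < r)
    (hcyc : CyclicSmallGain γ) :
    RobustlyGloballyAsymptoticallyStable (G.IsTrajectory J q Θ r T) where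
  wellPosed := StrategicGame.existsUnique_isTrajectory hJ hG hΘ.le hr
  lagrange R := ⟨∑ i, (gainBound γ R.toNNReal i : ℝ), fun _ _ _ hξ hR =>
    hξ.norm_le hJ hG hcyc hΘ hr (hR.trans (Real.le_coe_toNNReal R))⟩
  lyapunov ε hε := by
    obtain ⟨δ, hδ0, hδ⟩ := exists_sum_gainBound_lt hG.isClassN hε
    exact ⟨δ, hδ0, fun _ _ _ hξ hδx t => (hξ.norm_le hJ hG hcyc hΘ hr hδx t).trans hδ.le⟩
  attractive ε hε R := by
    obtain ⟨t₀, ht₀⟩ :=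
      StrategicGame.exists_forall_norm_isTrajectory_le hJ hG hcyc hΘ hr R.toNNReal hε
    exact ⟨t₀, fun x₀ u ξ hξ hR => ht₀ x₀ u ξ hξ (hR.trans (Real.le_coe_toNNReal R))⟩

theorem theorem4p2 {n : ℕ} (G : StrategicGame n)
    (qs : (i : Fin n) → G.S i) (hqs : G.IsNash qs)
    (γt : Fin n → Fin n → ℝ≥0 → ℝ≥0) (hγt : ∀ i j, j ≠ i → IsClassN (γt i j))
    (hgain : ∀ (i : Fin n) (q : (j : Fin n) → G.S j),
      ‖(G.bestReply i (fun j => q j) : EuclideanSpace ℝ (Fin (G.k i))) - qs i‖₊ ≤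
        Finset.univ.sup fun j : {j : Fin n // j ≠ i} =>
          γt i j ‖(q j : EuclideanSpace ℝ (Fin (G.k j))) - qs j‖₊)
    {m : ℕ} (J : Fin m → Set (Fin n)) (hJdisj : ∀ a b, a ≠ b → Disjoint (J a) (J b))
    (hJcover : ⋃ a, J a = Set.univ)
    (Θ r T : ℝ) (hΘ0 : 0 ≤ Θ) (hΘ1 : Θ < 1) (hr : 0 < r) (hrT : r ≤ T)
    (hsmall : ∃ ω : ℝ≥0, 1 < ω ∧ CyclicSmallGain fun i j s => ω * γt i j (ω * s)) :
    RobustlyGloballyAsymptoticallyStable (G.IsTrajectory J qs Θ r T) := by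
  obtain ⟨ω, hω, hcyc⟩ := hsmall
  exact theorem4p2_general G ⟨hγt, hgain⟩ (wellFounded_isRationalToward hJdisj) hΘ1 hr
    (hcyc.of_dilation hω.le fun i j hij => (hγt i j hij).monotone)
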